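/- A (single-party) box with binary input and binary output is a family $P=(P(a|x))_{a,x\in\{0,1\}}$ of nonnegative reals with $\sum_a P(a|x)=1$ for each $x$. An ensemble of $P$ is a finite family $(p_i,P^i)_i$ of probabilities $p_i\ge 0$, $\sum_i p_i=1$, and boxes $P^i$ with $P=\sum_i p_iP^i$; it is minimal if all $P^i$ are extreme points of the set of boxes and no proper subfamily of $(P^i)_i$, with any new probabilities, is an ensemble of $P$. A complete extension of $P$ is a bipartite non-signaling box $P_{AX}(a,e|x,z)$, where the extending party $X$ has finitely many inputs $z$ and, for each $z$, finitely many outputs $e$ (their number may depend on $z$), such that $P_{AX}(a,e|x,z)=p(e|z)\,P^{e,z}(a|x)$, where for every $z$ the family $(p(e|z),P^{e,z})_e$ is a minimal ensemble of $P$, and every minimal ensemble of $P$ arises in this way, up to relabeling of its members, from exactly one $z$. Such a $P_{AX}$ is called a vertex if it is an extreme point of the polytope of all bipartite non-signaling boxes with the same input and output alphabets. **Corollary.** Among all single-party boxes with binary input and binary output, exactly five have a complete extension which is a vertex: the four deterministic boxes $P(a|x)=\delta_{a,f(x)}$, $f:\{0,1\}\to\{0,1\}$, and the maximally mixed box $P(a|x)=\tfrac12$.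 For each of these five, every complete extension, whatever the labels of the inputs and outputs of $X$, is a vertex. -/

import Mathlib

namespace BoxWorld

/-- The set of single-party boxes with input alphabet `X` and output alphabet `A`: all conditional
probability distributions `P x a = p(a|x)`. -/
def boxes (X A : Type*) [Fintype A] : Set (X → A → ℝ) :=
  {P | (∀ x a, 0 ≤ P x a) ∧ ∀ x, ∑ a, P x a = 1}

/-- The set of bipartite non-signaling boxes `Q x z a e = p(a,e|x,z)`. The first party has inputs
`X` and outputs `A`; the second party has inputs `Z`, and for each input `z` its own output
alphabet `E z`. -/
def nsBoxes (X A Z : Type*) (E : Z → Type*) [Fintype A] [∀ z, Fintype (E z)] :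
    Set (X → (z : Z) → A → E z → ℝ) :=
  {Q | (∀ x z a e, 0 ≤ Q x z a e) ∧
    (∀ x z, ∑ a, ∑ e, Q x z a e = 1) ∧
    (∀ a x z z', ∑ e, Q x z a e = ∑ e, Q x z' a e) ∧
    (∀ x x' z e, ∑ a, Q x z a e = ∑ a, Q x' z a e)}

/-- The finite family `(p i, B i)` is an ensemble of the box `P`: a probability distribution `p`
and boxes `B i` with `P = ∑ i, p i • B i`. -/
structure IsEnsemble {X A ι : Type*} [Fintype A] [Fintype ι]
    (P : X → A → ℝ) (p : ι → ℝ) (B : ι → X → A → ℝ) : Prop where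
  nonneg : ∀ i, 0 ≤ p i
  sum_eq_one : ∑ i, p i = 1
  isBox : ∀ i, B i ∈ boxes X A
  average : ∑ i, p i • B i = P

/-- A minimal ensemble of `P`: all its members are extremal boxes, and no proper subfamily of the
members is, for any new choice of the probabilities, an ensemble of `P`. -/
structure IsMinimalEnsemble {X A ι : Type*} [Fintype A] [Fintype ι]
    (P : X → A → ℝ) (p : ι → ℝ) (B : ι → X → A → ℝ) : Prop where
  isEnsemble : IsEnsemble P p B
  isPure : ∀ i, B i ∈ (boxes X A).extremePoints ℝ
  isMinimal : ∀ J : Finset ι, J ≠ Finset.univ →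
    ∀ q : J → ℝ, ¬ IsEnsemble P q (fun i : J => B i)

/-- `Q` is a complete extension of the box `P`: each input `z` of the extending party generates a
minimal ensemble `(p z e, B z e)` of `P`, indexed by the outputs `e`, and each minimal ensemble of
`P` is generated, up to the naming of its members, by exactly one input. -/
def IsCompleteExtension {X A Z : Type*} {E : Z → Type*} [Fintype A] [∀ z, Fintype (E z)]
    (P : X → A → ℝ) (Q : X → (z : Z) → A → E z → ℝ) : Prop :=
  Q ∈ nsBoxes X A Z E ∧
  ∃ (p : (z : Z) → E z → ℝ) (B : (z : Z) → E z → X → A → ℝ),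
    (∀ x z a e, Q x z a e = p z e * B z e x a) ∧
    (∀ z, IsMinimalEnsemble P (p z) (B z)) ∧
    (∀ (n : ℕ) (q : Fin n → ℝ) (C : Fin n → X → A → ℝ), IsMinimalEnsemble P q C →
      ∃! z : Z, ∃ σ : Fin n ≃ E z, ∀ i, p z (σ i) = q i ∧ B z (σ i) = C i)

/-- `Q` is a vertex of the polytope of bipartite non-signaling boxes with its alphabets. -/
def IsVertex {X A Z : Type*} {E : Z → Type*} [Fintype A] [∀ z, Fintype (E z)]
    (Q : X → (z : Z) → A → E z → ℝ) : Prop :=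
  Q ∈ (nsBoxes X A Z E).extremePoints ℝ

/-- `P` has a purification: a complete extension, to a system with finitely many inputs and
outputs, which is a vertex. -/
def HasPurification {X A : Type*} [Fintype A] (P : X → A → ℝ) : Prop :=
  ∃ (Z : Type) (_ : Fintype Z) (E : Z → Type) (_ : ∀ z, Fintype (E z))
    (Q : X → (z : Z) → A → E z → ℝ), IsCompleteExtension P Q ∧ IsVertex Q

/-- The deterministic box that answers the input `x` with `f x`. -/
def deterministicBox {X A : Type*} [DecidableEq A] (f : X → A) : X → A → ℝ :=
  fun x a => if a = f x then 1 else 0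

/-- The maximally mixed box: every output is uniform, for every input. -/
noncomputable def maximallyMixedBox (X A : Type*) [Fintype A] : X → A → ℝ :=
  fun _ _ => 1 / (Fintype.card A : ℝ)

end BoxWorld

namespace BoxWorld

/-! ### Boxes and their ensembles -/

section General

/-! Extremal boxes are deterministic, so in any convex decomposition of a complete extension each
part keeps the same zeros. A part thus differs from the extension only in its weights, and
non-signaling makes it a reweighting of all the ensembles to one common average `R`. Being a vertex
means that no other such reweighting exists. For a deterministic `P` each minimal ensemble has one
member. For the mixed box the minimal ensembles are the two antipodal pairs of strategies, and
together they force `R` to be uniform. For any other binary `P` some `R ≠ P` is reachable from every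
ensemble (`exists_common_average`): the mixed box if `P` has full support, a deterministic box
otherwise. Small steps towards and away from `R` then refute extremality
(`not_isVertex_of_isEnsemble`). -/

theorem deterministicBox_injective {X A : Type*} [DecidableEq A] :
    Function.Injective (deterministicBox : (X → A) → X → A → ℝ) := by
  intro f g h
  ext x
  have := congrFun (congrFun h x) (f x)
  simpa [deterministicBox] using this

variable {X A : Type*} [Fintype A]

/-- Boxes form a product of simplices, one per input, and convex hulls commute with products. -/
theorem boxes_eq_convexHull [Finite X] [DecidableEq A] :
    boxes X A = convexHull ℝ (Set.range (deterministicBox : (X → A) → X → A → ℝ)) := by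
  have h₁ : boxes X A = Set.univ.pi fun _ : X => stdSimplex ℝ A := by
    ext P
    simp [boxes, stdSimplex, forall_and]
  have h₂ : Set.range (deterministicBox : (X → A) → X → A → ℝ) =
      Set.univ.pi fun _ : X => Set.range fun a : A => (Pi.single a 1 : A → ℝ) := by
    ext P
    simp only [Set.mem_range, Set.mem_univ_pi]
    constructor
    · rintro ⟨f, rfl⟩ x
      exact ⟨f x, by ext a; simp [deterministicBox, Pi.single_apply]⟩
    · intro h
      choose f hf using h
      exact ⟨f, by ext x a; simp [deterministicBox, ← hf, Pi.single_apply]⟩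
  rw [h₁, h₂, convexHull_pi]
  simp_rw [convexHull_rangle_single_eq_stdSimplex]

theorem deterministicBox_mem_boxes [DecidableEq A] (f : X → A) :
    deterministicBox f ∈ boxes X A :=
  ⟨fun x a => by unfold deterministicBox; split_ifs <;> simp, fun x => by simp [deterministicBox]⟩

theorem eq_deterministicBox_of_apply_eq_zero [DecidableEq A] {P : X → A → ℝ} (hP : P ∈ boxes X A)
    {f : X → A} (h : ∀ x a, a ≠ f x → P x a = 0) : P = deterministicBox f := by
  ext x a
  unfold deterministicBox
  split_ifs with ha
  · subst ha
    rw [← hP.2 x, Finset.sum_eq_single_of_mem (f x) (Finset.mem_univ _) fun b _ hb => h x b hb]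
  · exact h x a ha

theorem extremePoints_boxes [Finite X] [DecidableEq A] :
    (boxes X A).extremePoints ℝ =
      Set.range (deterministicBox : (X → A) → X → A → ℝ) := by
  refine Set.Subset.antisymm ?_ ?_
  · rw [boxes_eq_convexHull]
    exact extremePoints_convexHull_subset
  · rintro _ ⟨f, rfl⟩
    refine ⟨deterministicBox_mem_boxes f, ?_⟩
    rintro P₁ h₁ P₂ h₂ ⟨s, t, hs, ht, -, h⟩
    refine eq_deterministicBox_of_apply_eq_zero h₁ fun x a ha => ?_
    have hxa := congrFun (congrFun h x) a
    simp only [Pi.add_apply, Pi.smul_apply, smul_eq_mul, deterministicBox, if_neg ha] at hxa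
    have := mul_nonneg ht.le (h₂.1 x a)
    have := mul_nonneg hs.le (h₁.1 x a)
    exact (mul_eq_zero.1 (by linarith)).resolve_left hs.ne'

variable {ι : Type*} [Fintype ι] {P : X → A → ℝ} {p : ι → ℝ} {B : ι → X → A → ℝ}

theorem IsEnsemble.sum_mul (h : IsEnsemble P p B) (x : X) (a : A) :
    ∑ i, p i * B i x a = P x a := by
  rw [← h.average]
  simp [Finset.sum_apply]

theorem IsEnsemble.mem_boxes (h : IsEnsemble P p B) : P ∈ boxes X A := by
  refine ⟨fun x a => ?_, fun x => ?_⟩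
  · rw [← h.sum_mul]
    exact Finset.sum_nonneg fun i _ => mul_nonneg (h.nonneg i) ((h.isBox i).1 x a)
  · simp_rw [← h.sum_mul]
    rw [Finset.sum_comm]
    simp_rw [← Finset.mul_sum, (h.isBox _).2, mul_one, h.sum_eq_one]

/-- If the answer `a` to `x` has positive probability, then so it has in a member of positive
weight. -/
theorem IsEnsemble.exists_pos (h : IsEnsemble P p B) {x : X} {a : A} (hP : 0 < P x a) :
    ∃ i, 0 < p i ∧ 0 < B i x a := by
  by_contra! hc
  refine hP.not_ge ((h.sum_mul x a).symm.trans_le (Finset.sum_nonpos fun i _ => ?_))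
  rcases (h.nonneg i).eq_or_lt with h0 | h0
  · simp [← h0]
  · exact mul_nonpos_of_nonneg_of_nonpos h0.le (hc i h0)

theorem IsEnsemble.exists_weight_pos (h : IsEnsemble P p B) : ∃ i, 0 < p i := by
  by_contra! hc
  have := Finset.sum_nonpos fun i (_ : i ∈ Finset.univ) => hc i
  linarith [h.sum_eq_one]

theorem IsEnsemble.apply_eq_zero (h : IsEnsemble P p B) {x : X} {a : A} (hP : P x a = 0) {i : ι}
    (hi : 0 < p i) : B i x a = 0 := by
  have := (Finset.sum_eq_zero_iff_of_nonneg fun i _ =>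
    mul_nonneg (h.nonneg i) ((h.isBox i).1 x a)).1 ((h.sum_mul x a).trans hP) i (Finset.mem_univ i)
  exact (mul_eq_zero.1 this).resolve_left hi.ne'

/-- An ensemble of `P` and an ensemble of `R` with the same members combine to an ensemble of each
affine combination of `P` and `R` with nonnegative weights. -/
theorem IsEnsemble.affine {R : X → A → ℝ} {v : ι → ℝ} (h : IsEnsemble P p B)
    (h' : IsEnsemble R v B) {s : ℝ} (hs : ∀ i, 0 ≤ p i + s * (v i - p i)) :
    IsEnsemble (P + s • (R - P)) (fun i => p i + s * (v i - p i)) B where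
  nonneg := hs
  sum_eq_one := by
    rw [Finset.sum_add_distrib, ← Finset.mul_sum, Finset.sum_sub_distrib, h.sum_eq_one,
      h'.sum_eq_one]
    ring
  isBox := h.isBox
  average := by
    rw [← h.average, ← h'.average, ← Finset.sum_sub_distrib, Finset.smul_sum,
      ← Finset.sum_add_distrib]
    refine Finset.sum_congr rfl fun i _ => ?_
    rw [add_smul, mul_smul, sub_smul]

theorem IsMinimalEnsemble.exists_eq_deterministicBox [Finite X] [DecidableEq A]
    (h : IsMinimalEnsemble P p B) : ∃ g : ι → X → A, B = fun i => deterministicBox (g i) := by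
  have := h.isPure
  simp_rw [extremePoints_boxes] at this
  choose g hg using this
  exact ⟨g, funext fun i => (hg i).symm⟩

/-- An ensemble of extreme points with the fewest members is minimal. This guarantees that a
complete extension has an input. -/
theorem exists_isMinimalEnsemble [Finite X] (hP : P ∈ boxes X A) :
    ∃ (n : ℕ) (q : Fin n → ℝ) (C : Fin n → X → A → ℝ), IsMinimalEnsemble P q C := by
  classical
  have reindex : ∀ (κ : Type) [Fintype κ] (q : κ → ℝ) (C : κ → X → A → ℝ), IsEnsemble P q C →
      (∀ i, C i ∈ (boxes X A).extremePoints ℝ) →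
      ∃ (q : Fin (Fintype.card κ) → ℝ) (C : Fin (Fintype.card κ) → X → A → ℝ),
        IsEnsemble P q C ∧ ∀ i, C i ∈ (boxes X A).extremePoints ℝ := by
    intro κ _ q C h hC
    let σ := (Fintype.equivFin κ).symm
    refine ⟨q ∘ σ, C ∘ σ, ⟨fun i => h.nonneg _, ?_, fun i => h.isBox _, ?_⟩, fun i => hC _⟩
    · exact (σ.sum_comp q).trans h.sum_eq_one
    · exact (σ.sum_comp fun i => q i • C i).trans h.average
  have hex : ∃ n : ℕ, ∃ (q : Fin n → ℝ) (C : Fin n → X → A → ℝ),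
      IsEnsemble P q C ∧ ∀ i, C i ∈ (boxes X A).extremePoints ℝ := by
    have hP' := hP
    rw [boxes_eq_convexHull, mem_convexHull_iff_exists_fintype] at hP'
    obtain ⟨κ, _, q, C, h₀, h₁, hC, hav⟩ := hP'
    rw [← extremePoints_boxes] at hC
    exact ⟨_, reindex κ q C ⟨h₀, h₁, fun i => (hC i).1, hav⟩ hC⟩
  obtain ⟨q, C, h, hC⟩ := Nat.find_spec hex
  refine ⟨Nat.find hex, q, C, h, hC, fun J hJ q' h' => ?_⟩
  refine Nat.find_min hex ?_ (reindex J q' _ h' fun i => hC i)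
  simpa using Finset.card_lt_card (Finset.ssubset_univ_iff.2 hJ)

/-! ### Extremality of extensions in terms of reweighted ensembles -/

section Extension

variable {Z : Type*} {E : Z → Type*} [∀ z, Fintype (E z)]
  {w : (z : Z) → E z → ℝ} {D : (z : Z) → E z → X → A → ℝ}

theorem mem_nsBoxes_of_isEnsemble (h : ∀ z, IsEnsemble P (w z) (D z)) :
    (fun x z a e => w z e * D z e x a) ∈ nsBoxes X A Z E := by
  refine ⟨fun x z a e => mul_nonneg ((h z).nonneg e) (((h z).isBox e).1 x a), fun x z => ?_,
    fun a x z z' => ?_, fun x x' z e => ?_⟩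
  · simp_rw [(h z).sum_mul]
    exact (h z).mem_boxes.2 x
  · rw [(h z).sum_mul, (h z').sum_mul]
  · simp_rw [← Finset.mul_sum, ((h z).isBox e).2]

/-- If each ensemble generated by the extension can be reweighted to an ensemble of one and the
same box `R ≠ P`, then the extension can be moved in the direction of `R` and in the opposite
direction. -/
theorem not_isVertex_of_isEnsemble [Finite Z] [Nonempty Z] {R : X → A → ℝ}
    {v : (z : Z) → E z → ℝ} (h : ∀ z, IsEnsemble P (w z) (D z)) (h' : ∀ z, IsEnsemble R (v z) (D z))
    (hv : ∀ z e, w z e = 0 → v z e = 0) (hR : R ≠ P) :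
    ¬ IsVertex fun x z a e => w z e * D z e x a := by
  intro hvert
  obtain ⟨M, hM⟩ : ∃ M : ℝ, ∀ z e, v z e / w z e ≤ M := by
    obtain ⟨M, hM⟩ := (Set.finite_range fun i : Σ z, E z => v i.1 i.2 / w i.1 i.2).bddAbove
    exact ⟨M, fun z e => hM ⟨⟨z, e⟩, rfl⟩⟩
  -- Where `w` vanishes the quotient above carries no information, and `hv` takes over.
  have hvM : ∀ z e, v z e ≤ max M 1 * w z e := by
    intro z e
    rcases ((h z).nonneg e).eq_or_lt with h0 | h0
    · rw [hv z e h0.symm, ← h0, mul_zero]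
    · exact ((div_le_iff₀ h0).1 (hM z e)).trans
        (mul_le_mul_of_nonneg_right (le_max_left _ _) h0.le)
  have hM1 : 1 ≤ max M 1 := le_max_right _ _
  generalize max M 1 = K at hvM hM1
  -- The step `K⁻¹` keeps weights nonnegative both ways: forwards by `K⁻¹ ≤ 1`, backwards by `v ≤ K
  -- * w`.
  have hK : 0 < K⁻¹ := by positivity
  have hK1 : K⁻¹ ≤ 1 := inv_le_one_of_one_le₀ hM1
  have hplus := fun z => (h z).affine (h' z) (s := K⁻¹) fun e => by
    have := mul_nonneg hK.le ((h' z).nonneg e)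
    have := mul_le_mul_of_nonneg_right hK1 ((h z).nonneg e)
    linarith
  have hminus := fun z => (h z).affine (h' z) (s := -K⁻¹) fun e => by
    have h1 := mul_le_mul_of_nonneg_left (hvM z e) hK.le
    rw [inv_mul_cancel_left₀ (by positivity)] at h1
    have := mul_nonneg hK.le ((h z).nonneg e)
    linarith
  have heq := hvert.2 (mem_nsBoxes_of_isEnsemble hplus) (mem_nsBoxes_of_isEnsemble hminus)
    ⟨1 / 2, 1 / 2, by norm_num, by norm_num, by norm_num, by
      ext x z a e
      simp only [Pi.add_apply, Pi.smul_apply, smul_eq_mul]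
      ring⟩
  obtain ⟨z⟩ := ‹Nonempty Z›
  refine hR ?_
  ext x a
  have h1 := (hplus z).sum_mul x a
  have h2 : ∀ e, (w z e + K⁻¹ * (v z e - w z e)) * D z e x a = w z e * D z e x a := fun e =>
    congrFun (congrFun (congrFun (congrFun heq x) z) a) e
  simp_rw [h2, (h z).sum_mul] at h1
  simp only [Pi.add_apply, Pi.smul_apply, Pi.sub_apply, smul_eq_mul, left_eq_add] at h1
  linarith [(mul_eq_zero.1 h1).resolve_left hK.ne']

/-- An extension with deterministic members is a vertex as soon as its ensembles are the only ones
with these members that have a common average. -/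
theorem isVertex_of_forall_isEnsemble [Nonempty X] [DecidableEq A]
    {g : (z : Z) → E z → X → A}
    (h : ∀ z, IsEnsemble P (w z) fun e => deterministicBox (g z e))
    (huniq : ∀ (R : X → A → ℝ) (v : (z : Z) → E z → ℝ),
      (∀ z, IsEnsemble R (v z) fun e => deterministicBox (g z e)) → v = w) :
    IsVertex fun x z a e => w z e * deterministicBox (g z e) x a := by
  refine ⟨mem_nsBoxes_of_isEnsemble h, ?_⟩
  rintro Q h₁ Q₂ h₂ ⟨s, t, hs, ht, -, hst⟩
  have hzero : ∀ x z a e, a ≠ g z e x → Q x z a e = 0 := by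
    intro x z a e ha
    have hq := congrFun (congrFun (congrFun (congrFun hst x) z) a) e
    simp only [Pi.add_apply, Pi.smul_apply, smul_eq_mul, deterministicBox, if_neg ha,
      mul_zero] at hq
    have := mul_nonneg ht.le (h₂.1 x z a e)
    have := mul_nonneg hs.le (h₁.1 x z a e)
    exact (mul_eq_zero.1 (by linarith)).resolve_left hs.ne'
  obtain ⟨x₀⟩ := ‹Nonempty X›
  -- By non-signaling the choice of `x₀` is immaterial.
  let v : (z : Z) → E z → ℝ := fun z e => ∑ a, Q x₀ z a e
  have hQ : Q = fun x z a e => v z e * deterministicBox (g z e) x a := by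
    ext x z a e
    simp only [v]
    rw [h₁.2.2.2 x₀ x z e, Finset.sum_eq_single_of_mem (g z e x) (Finset.mem_univ _)
      fun b _ hb => hzero x z b e hb]
    unfold deterministicBox
    split_ifs with ha
    · rw [ha, mul_one]
    · rw [mul_zero, hzero x z a e ha]
  rcases isEmpty_or_nonempty Z with hZ | ⟨⟨z₀⟩⟩
  · funext x z
    exact hZ.elim z
  have hv : v = w := by
    -- The common average is the first party's marginal of `Q`, which does not depend on `z`.
    refine huniq (fun x a => ∑ e, Q x z₀ a e) v fun z => ⟨fun e => ?_, ?_, fun e => ?_, ?_⟩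
    · exact Finset.sum_nonneg fun a _ => h₁.1 _ _ _ _
    · exact Finset.sum_comm.trans (h₁.2.1 x₀ z)
    · exact deterministicBox_mem_boxes _
    · ext x a
      rw [h₁.2.2.1 a x z₀ z, hQ]
      simp [Finset.sum_apply]
  rw [hQ, hv]

end Extension

end General

/-! ### Ensembles of a deterministic box -/

section Deterministic

variable {X A : Type*} [Fintype A] [DecidableEq A]

/-- A member that answers as `f` does, taken with certainty, is an ensemble. -/
theorem isEnsemble_single {ι : Type*} [Fintype ι] [DecidableEq ι] {g : ι → X → A} (i : ι) :
    IsEnsemble (deterministicBox (g i)) (Pi.single i 1) fun k => deterministicBox (g k) where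
  nonneg k := by
    by_cases hk : k = i
    · simp [hk]
    · simp [hk]
  sum_eq_one := by simp
  isBox k := deterministicBox_mem_boxes _
  average := by
    rw [Finset.sum_eq_single_of_mem i (Finset.mem_univ i) fun k _ hk => by simp [hk]]
    simp

theorem IsEnsemble.eq_of_deterministicBox {ι : Type*} [Fintype ι] {p : ι → ℝ} {f : X → A}
    {g : ι → X → A} (h : IsEnsemble (deterministicBox f) p fun i => deterministicBox (g i)) {i : ι}
    (hi : 0 < p i) : g i = f := by
  ext x
  by_contra hne
  have := h.apply_eq_zero (x := x) (a := g i x) (by simp [deterministicBox, hne]) hi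
  simp [deterministicBox] at this

/-- A member of positive weight equals the box, so alone it is an ensemble; minimality excludes all
others. -/
theorem IsMinimalEnsemble.subsingleton {ι : Type*} [Fintype ι] {p : ι → ℝ} {f : X → A}
    {g : ι → X → A}
    (h : IsMinimalEnsemble (deterministicBox f) p fun i => deterministicBox (g i)) :
    Subsingleton ι := by
  classical
  obtain ⟨i, hi⟩ := h.isEnsemble.exists_weight_pos
  have hg := h.isEnsemble.eq_of_deterministicBox hi
  have huniv : ({i} : Finset ι) = Finset.univ := by
    by_contra hne
    refine h.isMinimal {i} hne _
      (hg ▸ isEnsemble_single (g := fun k : ({i} : Finset ι) => g k) ⟨i, by simp⟩)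
  exact ⟨fun j k => by
    have hj := huniv ▸ Finset.mem_univ j
    have hk := huniv ▸ Finset.mem_univ k
    rw [Finset.mem_singleton.1 hj, Finset.mem_singleton.1 hk]⟩

theorem isMinimalEnsemble_deterministicBox [Finite X] (f : X → A) :
    IsMinimalEnsemble (deterministicBox f) (fun _ : Unit => 1) fun _ => deterministicBox f where
  isEnsemble := ⟨fun _ => zero_le_one, by simp, fun _ => deterministicBox_mem_boxes f, by simp⟩
  isPure _ := by
    rw [extremePoints_boxes]
    exact ⟨f, rfl⟩
  isMinimal J hJ q h := by
    obtain ⟨⟨i, hi⟩, -⟩ := h.exists_weight_pos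
    exact hJ (Finset.eq_univ_iff_forall.2 fun _ => hi)

end Deterministic

theorem eq_of_ne_of_ne {a b c : Fin 2} (ha : a ≠ c) (hb : b ≠ c) : a = b := by
  omega

/-! ### Binary boxes and antipodal pairs of strategies -/

section Binary

variable {ι : Type*} [Fintype ι] {P R : Fin 2 → Fin 2 → ℝ} {p v : ι → ℝ} {g : ι → Fin 2 → Fin 2}

/-- An ensemble of a box in which every answer is possible has two members, of positive weights,
that never give the same answer. -/
theorem IsEnsemble.exists_antipodal (h : IsEnsemble P p fun i => deterministicBox (g i))
    (hP : ∀ x a, 0 < P x a) : ∃ i j, 0 < p i ∧ 0 < p j ∧ ∀ x, g i x ≠ g j x := by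
  have key : ∀ x a, ∃ i, 0 < p i ∧ g i x = a := by
    intro x a
    obtain ⟨i, hi, hpos⟩ := h.exists_pos (hP x a)
    refine ⟨i, hi, ?_⟩
    by_contra hne
    simp [deterministicBox, Ne.symm hne] at hpos
  obtain ⟨i, hi, hi0⟩ := key 0 0
  obtain ⟨j, hj, hj1⟩ := key 1 (g i 1 + 1)
  obtain ⟨k, hk, hk0⟩ := key 0 1
  by_cases hj0 : g j 0 = 1
  · exact ⟨i, j, hi, hj, Fin.forall_fin_two.2 ⟨by omega, by omega⟩⟩
  -- Here `i` and `j` agree on input 0 and differ on input 1, while `k` differs from both on input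
  -- 0, so `k` is antipodal to one of them.
  by_cases hk1 : g k 1 = g i 1
  · exact ⟨j, k, hj, hk, Fin.forall_fin_two.2 ⟨by omega, by omega⟩⟩
  · exact ⟨i, k, hi, hk, Fin.forall_fin_two.2 ⟨by omega, by omega⟩⟩

theorem isEnsemble_antipodal [DecidableEq ι] {i j : ι} (hij : ∀ x, g i x ≠ g j x) :
    IsEnsemble (maximallyMixedBox (Fin 2) (Fin 2))
      (Pi.single i (1 / 2) + Pi.single j (1 / 2) : ι → ℝ) fun k => deterministicBox (g k) where
  nonneg k := by
    have : ∀ l : ι, 0 ≤ (Pi.single l (1 / 2) : ι → ℝ) k := fun l => by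
      rw [Pi.single_apply]
      split_ifs <;> norm_num
    exact add_nonneg (this i) (this j)
  sum_eq_one := by
    simp only [Pi.add_apply, Finset.sum_add_distrib, Finset.sum_pi_single', Finset.mem_univ,
      if_true]
    norm_num
  isBox k := deterministicBox_mem_boxes _
  average := by
    have hsingle : ∀ l : ι, ∑ k, (Pi.single l (1 / 2) : ι → ℝ) k • deterministicBox (g k) =
        (1 / 2 : ℝ) • deterministicBox (g l) := fun l => by
      rw [Finset.sum_eq_single_of_mem l (Finset.mem_univ l) fun k _ hk => by simp [hk]]
      simp
    simp only [Pi.add_apply, add_smul, Finset.sum_add_distrib, hsingle]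
    ext x a
    have := hij x
    simp only [Pi.add_apply, Pi.smul_apply, smul_eq_mul, deterministicBox, maximallyMixedBox,
      Fintype.card_fin]
    by_cases ha : a = g i x
    · rw [if_pos ha, if_neg (by omega)]
      norm_num
    · rw [if_neg ha, if_pos (by omega)]
      norm_num

theorem maximallyMixedBox_pos (x a : Fin 2) : 0 < maximallyMixedBox (Fin 2) (Fin 2) x a := by
  simp [maximallyMixedBox]

/-- An antipodal pair with weights 1/2 is already an ensemble, so by minimality it exhausts the
family. -/
theorem IsMinimalEnsemble.exists_antipodal
    (h : IsMinimalEnsemble (maximallyMixedBox (Fin 2) (Fin 2)) p fun i => deterministicBox (g i)) :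
    ∃ i j, (∀ x, g i x ≠ g j x) ∧ ∀ k, k = i ∨ k = j := by
  classical
  obtain ⟨i, j, -, -, hij⟩ := h.isEnsemble.exists_antipodal maximallyMixedBox_pos
  refine ⟨i, j, hij, fun k => ?_⟩
  have huniv : ({i, j} : Finset ι) = Finset.univ := by
    by_contra hne
    exact h.isMinimal {i, j} hne _
      (isEnsemble_antipodal (g := fun k : ({i, j} : Finset ι) => g k) (i := ⟨i, by simp⟩)
        (j := ⟨j, by simp⟩) hij)
  have hk := Finset.mem_univ k
  rw [← huniv] at hk
  simpa using hk

/-- The members of a minimal ensemble of the maximally mixed box are told apart by any answer. -/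
theorem IsMinimalEnsemble.injective_apply
    (h : IsMinimalEnsemble (maximallyMixedBox (Fin 2) (Fin 2)) p fun i => deterministicBox (g i))
    (x : Fin 2) : Function.Injective fun i => g i x := by
  obtain ⟨i, j, hij, hcov⟩ := h.exists_antipodal
  intro k l hkl
  have := hij x
  rcases hcov k with rfl | rfl <;> rcases hcov l with rfl | rfl <;> simp_all

/-- Only member `i` gives the answer `g i x`, so that answer's probability is its weight. -/
theorem IsEnsemble.weight_eq (h : IsEnsemble R v fun i => deterministicBox (g i)) {x : Fin 2}
    (hg : Function.Injective fun i => g i x) (i : ι) : v i = R x (g i x) := by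
  rw [← h.sum_mul, Finset.sum_eq_single_of_mem i (Finset.mem_univ i) fun k _ hk => ?_]
  · simp [deterministicBox]
  · have : g i x ≠ g k x := fun heq => hk (hg heq.symm)
    simp [deterministicBox, this]

/-- The strategies whose answers to the two questions differ by `c`. -/
def diagonal (c e : Fin 2) : Fin 2 → Fin 2 :=
  ![e, e + c]

theorem isMinimalEnsemble_diagonal (c : Fin 2) :
    IsMinimalEnsemble (maximallyMixedBox (Fin 2) (Fin 2)) (fun _ : Fin 2 => 1 / 2)
      fun e => deterministicBox (diagonal c e) where
  isEnsemble := by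
    have h := isEnsemble_antipodal (g := diagonal c) (i := 0) (j := 1)
      (Fin.forall_fin_two.2 ⟨by simp [diagonal], by simp [diagonal]⟩)
    convert h using 1
    ext e
    fin_cases e <;> simp
  isPure e := by
    rw [extremePoints_boxes]
    exact ⟨_, rfl⟩
  isMinimal J hJ q h := by
    obtain ⟨i, j, -, -, hij⟩ := h.exists_antipodal maximallyMixedBox_pos
    refine hJ (Finset.eq_univ_iff_forall.2 fun k => ?_)
    have hne : (i : Fin 2) ≠ j := fun heq => hij 0 (by rw [heq])
    by_cases hk : k = i
    · exact hk ▸ i.2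
    · rw [eq_of_ne_of_ne hk hne.symm]
      exact j.2

theorem isCompleteExtension_maximallyMixedBox :
    IsCompleteExtension (Z := Fin 2) (E := fun _ => Fin 2) (maximallyMixedBox (Fin 2) (Fin 2))
      fun x z a e => 1 / 2 * deterministicBox (diagonal z e) x a := by
  refine ⟨mem_nsBoxes_of_isEnsemble fun z => (isMinimalEnsemble_diagonal z).isEnsemble, _,
    fun z e => deterministicBox (diagonal z e), fun _ _ _ _ => rfl, isMinimalEnsemble_diagonal,
    fun n q C h => ?_⟩
  obtain ⟨g, rfl⟩ := h.exists_eq_deterministicBox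
  obtain ⟨i, j, hij, hcov⟩ := h.exists_antipodal
  have hinj := h.injective_apply
  have hne : i ≠ j := fun heq => hij 0 (by rw [heq])
  have hbij : Function.Bijective fun k => g k 0 := by
    refine ⟨hinj 0, fun a => ?_⟩
    by_cases ha : a = g i 0
    · exact ⟨i, ha.symm⟩
    · exact ⟨j, eq_of_ne_of_ne (hij 0).symm ha⟩
  -- Antipodal strategies share the difference of their answers mod 2, which gives the input; the
  -- answer to 0 labels the member.
  refine ⟨g i 1 - g i 0, ⟨Equiv.ofBijective _ hbij, fun k => ⟨?_, ?_⟩⟩, ?_⟩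
  · rw [h.isEnsemble.weight_eq (hinj 0) k]
    simp [maximallyMixedBox]
  · refine congrArg deterministicBox (funext (Fin.forall_fin_two.2 ⟨rfl, ?_⟩))
    have h0 := hij 0
    have h1 := hij 1
    simp only [Equiv.ofBijective_apply, diagonal, Matrix.cons_val_one, Matrix.cons_val_fin_one]
    rcases hcov k with rfl | rfl <;> omega
  · rintro z ⟨σ, hσ⟩
    have hd := deterministicBox_injective (hσ i).2
    rw [← hd]
    simp [diagonal]

theorem isCompleteExtension_deterministicBox {X A : Type*} [Finite X] [Fintype A] [DecidableEq A]
    (f : X → A) :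
    IsCompleteExtension (Z := Unit) (E := fun _ => Unit) (deterministicBox f)
      fun x _ a _ => 1 * deterministicBox f x a := by
  refine ⟨mem_nsBoxes_of_isEnsemble fun _ => (isMinimalEnsemble_deterministicBox f).isEnsemble,
    fun _ _ => 1, fun _ _ => deterministicBox f, fun _ _ _ _ => rfl,
    fun _ => isMinimalEnsemble_deterministicBox f, fun n q C h => ?_⟩
  obtain ⟨g, rfl⟩ := h.exists_eq_deterministicBox
  have := h.subsingleton
  obtain ⟨i, hi⟩ := h.isEnsemble.exists_weight_pos
  have : Unique (Fin n) := uniqueOfSubsingleton i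
  refine ⟨(), ⟨Equiv.ofUnique _ _, fun k => ?_⟩, fun _ _ => rfl⟩
  obtain rfl := Subsingleton.elim i k
  refine ⟨?_, by simp [h.isEnsemble.eq_of_deterministicBox hi]⟩
  have hsum := h.isEnsemble.sum_eq_one
  rw [Fintype.sum_subsingleton _ i] at hsum
  exact hsum.symm

theorem IsCompleteExtension.isVertex_of_deterministicBox {X A Z : Type*} {E : Z → Type*} [Finite X]
    [Nonempty X] [Fintype A] [DecidableEq A] [∀ z, Fintype (E z)] {f : X → A}
    {Q : X → (z : Z) → A → E z → ℝ} (h : IsCompleteExtension (deterministicBox f) Q) :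
    IsVertex Q := by
  obtain ⟨-, w, D, hQ, hmin, -⟩ := h
  choose g hg using fun z => (hmin z).exists_eq_deterministicBox
  obtain rfl : D = fun z e => deterministicBox (g z e) := funext hg
  obtain rfl : Q = fun x z a e => w z e * deterministicBox (g z e) x a := by
    funext x z a e
    exact hQ x z a e
  refine isVertex_of_forall_isEnsemble (fun z => (hmin z).isEnsemble) fun R v hv => ?_
  ext z e
  have := (hmin z).subsingleton
  have h₁ := (hv z).sum_eq_one
  have h₂ := (hmin z).isEnsemble.sum_eq_one
  rw [Fintype.sum_subsingleton _ e] at h₁ h₂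
  rw [h₁, h₂]

/-- In the ensemble of difference `c`, the weight of the strategy answering 0 and `c` is both `R 0
0` and `R 1 c`. Hence `R 1 0 = R 1 1`, and normalization makes `R` uniform. -/
theorem IsCompleteExtension.isVertex_of_maximallyMixedBox {Z : Type*} {E : Z → Type*}
    [∀ z, Fintype (E z)] {Q : Fin 2 → (z : Z) → Fin 2 → E z → ℝ}
    (h : IsCompleteExtension (maximallyMixedBox (Fin 2) (Fin 2)) Q) : IsVertex Q := by
  obtain ⟨-, w, D, hQ, hmin, hall⟩ := h
  choose g hg using fun z => (hmin z).exists_eq_deterministicBox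
  obtain rfl : D = fun z e => deterministicBox (g z e) := funext hg
  obtain rfl : Q = fun x z a e => w z e * deterministicBox (g z e) x a := by
    funext x z a e
    exact hQ x z a e
  refine isVertex_of_forall_isEnsemble (fun z => (hmin z).isEnsemble) fun R v hv => ?_
  have hdiag : ∀ c, R 0 0 = R 1 c := by
    intro c
    obtain ⟨z, ⟨σ, hσ⟩, -⟩ := hall 2 _ _ (isMinimalEnsemble_diagonal c)
    have hd := deterministicBox_injective (hσ 0).2
    have h₀ := (hv z).weight_eq ((hmin z).injective_apply 0) (σ 0)
    have h₁ := (hv z).weight_eq ((hmin z).injective_apply 1) (σ 0)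
    rw [hd] at h₀ h₁
    simpa [diagonal] using h₀.symm.trans h₁
  ext z e
  rw [(hv z).weight_eq ((hmin z).injective_apply 0),
    (hmin z).isEnsemble.weight_eq ((hmin z).injective_apply 0)]
  have hR := (hv z).mem_boxes.2
  have hR₀ := hR 0
  have hR₁ := hR 1
  rw [Fin.sum_univ_two] at hR₀ hR₁
  have hd₀ := hdiag 0
  have hd₁ := hdiag 1
  suffices ∀ a, R 0 a = 1 / 2 by simp [this, maximallyMixedBox]
  exact Fin.forall_fin_two.2 ⟨by linarith, by linarith⟩

/-! ### Boxes without a purification -/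

theorem exists_deterministic_member {x₀ a₀ : Fin 2} (hP : P ∈ boxes (Fin 2) (Fin 2))
    (h₀ : P x₀ a₀ = 0) : ∃ f : Fin 2 → Fin 2, ∀ (κ : Type) [Fintype κ] (q : κ → ℝ)
      (g : κ → Fin 2 → Fin 2), IsEnsemble P q (fun i => deterministicBox (g i)) →
      ∃ i, 0 < q i ∧ g i = f := by
  obtain ⟨a₁, ha₁⟩ : ∃ a, 0 < P (x₀ + 1) a := by
    by_contra! hc
    have := Finset.sum_nonpos fun a (_ : a ∈ Finset.univ) => hc a
    linarith [hP.2 (x₀ + 1)]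
  -- The zero of `P` forces the answer to `x₀` in every member of positive weight, and some such
  -- member answers `a₁` to the other input.
  refine ⟨fun x => if x = x₀ then a₀ + 1 else a₁, fun κ _ q g h => ?_⟩
  obtain ⟨i, hi, hpos⟩ := h.exists_pos ha₁
  refine ⟨i, hi, funext fun x => ?_⟩
  split_ifs with hx
  · subst hx
    have hz := h.apply_eq_zero h₀ hi
    have : a₀ ≠ g i x := fun heq => by simp [deterministicBox, heq] at hz
    omega
  · obtain rfl : x = x₀ + 1 := by omega
    by_contra hne
    simp [deterministicBox, Ne.symm hne] at hpos

/-- Unless `P` is deterministic or maximally mixed, there is another box which is the average of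
the positive-weight members of each ensemble of `P` by deterministic boxes. -/
theorem exists_common_average (hP : P ∈ boxes (Fin 2) (Fin 2))
    (hdet : P ∉ Set.range (deterministicBox : (Fin 2 → Fin 2) → Fin 2 → Fin 2 → ℝ))
    (hmix : P ≠ maximallyMixedBox (Fin 2) (Fin 2)) :
    ∃ R, R ≠ P ∧ ∀ (κ : Type) [Fintype κ] (q : κ → ℝ) (g : κ → Fin 2 → Fin 2),
      IsEnsemble P q (fun i => deterministicBox (g i)) →
      ∃ v, IsEnsemble R v (fun i => deterministicBox (g i)) ∧ ∀ i, q i = 0 → v i = 0 := by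
  classical
  by_cases hpos : ∀ x a, 0 < P x a
  · refine ⟨_, hmix.symm, fun κ _ q g h => ?_⟩
    obtain ⟨i, j, hi, hj, hij⟩ := h.exists_antipodal hpos
    refine ⟨_, isEnsemble_antipodal hij, fun k hk => ?_⟩
    have hki : k ≠ i := by rintro rfl; exact hi.ne' hk
    have hkj : k ≠ j := by rintro rfl; exact hj.ne' hk
    simp [hki, hkj]
  · push Not at hpos
    obtain ⟨x, a, hxa⟩ := hpos
    obtain ⟨f, hf⟩ := exists_deterministic_member hP (le_antisymm hxa (hP.1 x a))
    refine ⟨deterministicBox f, fun heq => hdet ⟨f, heq⟩, fun κ _ q g h => ?_⟩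
    obtain ⟨i, hi, rfl⟩ := hf κ q g h
    refine ⟨_, isEnsemble_single i, fun k hk => ?_⟩
    have hki : k ≠ i := by rintro rfl; exact hi.ne' hk
    simp [hki]

theorem HasPurification.eq (hP : P ∈ boxes (Fin 2) (Fin 2)) (h : HasPurification P) :
    P ∈ Set.range (deterministicBox : (Fin 2 → Fin 2) → Fin 2 → Fin 2 → ℝ) ∪
      {maximallyMixedBox (Fin 2) (Fin 2)} := by
  by_contra hnot
  simp only [Set.mem_union, Set.mem_singleton_iff, not_or] at hnot
  obtain ⟨R, hR, hav⟩ := exists_common_average hP hnot.1 hnot.2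
  obtain ⟨Z, _, E, _, Q, ⟨-, w, D, hQ, hmin, hall⟩, hvert⟩ := h
  choose g hg using fun z => (hmin z).exists_eq_deterministicBox
  obtain rfl : D = fun z e => deterministicBox (g z e) := funext hg
  obtain rfl : Q = fun x z a e => w z e * deterministicBox (g z e) x a := by
    funext x z a e
    exact hQ x z a e
  obtain ⟨n, q, C, hC⟩ := exists_isMinimalEnsemble hP
  have : Nonempty Z := ⟨(hall n q C hC).choose⟩
  choose v hv hv0 using fun z => hav (E z) (w z) (g z) (hmin z).isEnsemble
  exact not_isVertex_of_isEnsemble (fun z => (hmin z).isEnsemble) hv hv0 hR hvert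

end Binary

end BoxWorld

theorem mainTheorem9 :
    {P : Fin 2 → Fin 2 → ℝ | P ∈ BoxWorld.boxes (Fin 2) (Fin 2) ∧ BoxWorld.HasPurification P} =
        Set.range (BoxWorld.deterministicBox : (Fin 2 → Fin 2) → Fin 2 → Fin 2 → ℝ) ∪
          {BoxWorld.maximallyMixedBox (Fin 2) (Fin 2)} ∧
      {P : Fin 2 → Fin 2 → ℝ |
        P ∈ BoxWorld.boxes (Fin 2) (Fin 2) ∧ BoxWorld.HasPurification P}.ncard = 5 ∧
      (∀ P ∈ BoxWorld.boxes (Fin 2) (Fin 2), BoxWorld.HasPurification P →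
        ∀ (Z : Type) (_ : Fintype Z) (E : Z → Type) (_ : ∀ z, Fintype (E z))
          (Q : Fin 2 → (z : Z) → Fin 2 → E z → ℝ),
          BoxWorld.IsCompleteExtension P Q → BoxWorld.IsVertex Q) := by
  have hset : {P : Fin 2 → Fin 2 → ℝ |
      P ∈ BoxWorld.boxes (Fin 2) (Fin 2) ∧ BoxWorld.HasPurification P} =
        Set.range (BoxWorld.deterministicBox : (Fin 2 → Fin 2) → Fin 2 → Fin 2 → ℝ) ∪
          {BoxWorld.maximallyMixedBox (Fin 2) (Fin 2)} := by
    refine Set.Subset.antisymm (fun P hP => hP.2.eq hP.1) ?_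
    rintro _ (⟨f, rfl⟩ | rfl)
    · have h := BoxWorld.isCompleteExtension_deterministicBox f
      exact ⟨BoxWorld.deterministicBox_mem_boxes f, Unit, inferInstance, fun _ => Unit,
        inferInstance, _, h, h.isVertex_of_deterministicBox⟩
    · have h := BoxWorld.isCompleteExtension_maximallyMixedBox
      exact ⟨(BoxWorld.isMinimalEnsemble_diagonal 0).isEnsemble.mem_boxes, Fin 2, inferInstance,
        fun _ => Fin 2, inferInstance, _, h, h.isVertex_of_maximallyMixedBox⟩
  refine ⟨hset, ?_, fun P hP hpur Z _ E _ Q hQ => ?_⟩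
  · have hnot : BoxWorld.maximallyMixedBox (Fin 2) (Fin 2) ∉
        Set.range (BoxWorld.deterministicBox : (Fin 2 → Fin 2) → Fin 2 → Fin 2 → ℝ) := by
      rintro ⟨f, hf⟩
      have := congrFun (congrFun hf 0) (f 0)
      norm_num [BoxWorld.deterministicBox, BoxWorld.maximallyMixedBox] at this
    rw [hset, Set.union_singleton, Set.ncard_insert_of_notMem hnot (Set.finite_range _),
      Set.ncard_range_of_injective BoxWorld.deterministicBox_injective]
    simp
  · rcases hpur.eq hP with ⟨f, rfl⟩ | rfl
    · exact hQ.isVertex_of_deterministicBox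
    · exact hQ.isVertex_of_maximallyMixedBox
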